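/- **Setting.** A *model set-up* consists of a dimension $d$, a measurable context space $\mathcal X\subseteq\mathbb R^d$, a probability distribution $P_{\mathcal X}$ with support $\mathcal X$, a price interval $[\underline p,\overline p]\subseteq[0,1]$ with $\underline p<\overline p$, and parameter classes $\Theta\subseteq\mathbb R^d$, $A\subseteq[0,\infty)$. Demand is linear, $f(u)=u$: a customer with context $x$ who is offered price $p$ has demand $y\in\{0,1\}$ with $\mathbb E[y\mid x,p]=f(x^\top\theta-\alpha p)=x^\top\theta-\alpha p$. Let $r_u(p)=p\,f(u-\alpha p)$. The set-up satisfies the *assumptions* if there are constants $0<B\le\tilde B$, $-B\le b_1\le b_2\le B$, $L_f$, $L_U$ and $\sigma_r,\sigma_x>0$ such that for all $\theta\in\Theta$, $\alpha\in A$: 1. for all $x\in\mathcal X$, $p\in[\underline p,\overline p]$: $x^\top\theta\in[b_1,b_2]$, $x^\top\theta-\alpha p\in[-\tilde B,\tilde B]$ and $f(x^\top\theta-\alpha p)\in[0,1]$; 2. $f$ is $C^2$ with $|f|,|f'|,|f''|\le L_f$ on $[-\tilde B,\tilde B]$, and for every $u\in[b_1,b_2]$ there is $p^*(u)\in(\underline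 p,\overline p)$ such that $r_u$ is non-decreasing on $[\underline p,p^*(u)]$, non-increasing on $[p^*(u),\overline p]$, and $r_u(p')\le r_u(p^*(u))-\frac{\sigma_r}{2}(p'-p^*(u))^2$ for all $p'\in[\underline p,\overline p]$; 3. $\Pr_{x\sim P_{\mathcal X}}[x^\top\theta\in U]\le L_U|U|/(2B)$ for every measurable $U\subseteq[-B,B]$, where $|U|$ is Lebesgue measure; 4. $P_{\mathcal X}$ has finite second moments and $\lambda_{\min}(\mathrm{Cov}(P_{\mathcal X}))\ge\sigma_x$. A policy $\pi:\mathcal X\to[\underline p,\overline p]$ is *$\delta_0$-utility fair* ($\delta_0$-UF) under $(\theta,\alpha)$ if $|\pi(x)-\pi(x')|\le\delta_0|(x-x')^\top\theta|$ for all $x,x'\in\mathcal X$; $\mathcal F_{\theta,\alpha}(\delta_0)$ is the set of these policies, and $R_{\theta,\alpha}(\pi)=\mathbb E_{x\sim P_{\mathcal X}}[\pi(x)(x^\top\theta-\alpha\pi(x))]$. A (possibly randomized) learning algorithm over $T$ periods chooses in each period $t$ a policy $\pi_t$ that depends measurably on its internal randomness and on the contexts, prices and demands of the earlier periods; then $x_t\sim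 P_{\mathcal X}$ arrives independently, the price $\pi_t(x_t)$ is offered, and a Bernoulli demand $y_t$ with mean $x_t^\top\theta-\alpha\pi_t(x_t)$ is observed. **Theorem ($T^{2/3}$ regret lower bound).** There is a universal constant $c>0$ such that for every $\delta_0\in(0,1/2]$ there are $\underline C>0$ and $T_0\in\mathbb N$ (depending only on $\delta_0$) and a model set-up, not depending on $T$, that satisfies the assumptions and for which the maximum of $R_{\theta,\alpha}$ over $\mathcal F_{\theta,\alpha}(\delta_0)$ is attained for all $(\theta,\alpha)\in\Theta\times A$, such that the following holds. For every $T$ and every learning algorithm over $T$ periods with $$\Pr_{\theta,\alpha}\big[\pi_1,\dots,\pi_T\in\mathcal F_{\theta,\alpha}(\delta_0)\big]\ge 0.95\qquad\text{for all }(\theta,\alpha)\in\Theta\times A,$$ one has $$\sup_{(\theta,\alpha)\in\Theta\times A}\mathbb E_{\theta,\alpha}\Big[\sum_{t=1}^T\Big(\max_{\pi\in\mathcal F_{\theta,\alpha}(\delta_0)}R_{\theta,\alpha}(\pi)-R_{\theta,\alpha}(\pi_t)\Big)\Big]\ \ge\ \underline C\,T^{2/3},$$ and if $T\ge T_0$,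 the same supremum is at least $c\,\delta_0^{2/3}\,T^{2/3}$. -/

import Mathlib

open MeasureTheory Set

noncomputable section

/-- A model set-up for contextual pricing: a context space `𝒳 ⊆ ℝᵈ`, the distribution `P` of the
contexts on `𝒳`, a price interval `[pLow, pHigh] ⊆ [0, 1]`, and the parameter classes
`Θ ⊆ ℝᵈ` and `A ⊆ ℝ₊` that contain the unknown `θ` and `α`. -/
structure PricingModel (d : ℕ) where
  𝒳 : Set (EuclideanSpace ℝ (Fin d))
  measurableSet_𝒳 : MeasurableSet 𝒳
  P : Measure 𝒳
  isProb : IsProbabilityMeasure P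
  /-- the support of `P` is all of `𝒳` -/
  fullSupport : P.IsOpenPosMeasure
  pLow : ℝ
  pHigh : ℝ
  pLow_nonneg : 0 ≤ pLow
  pLow_lt_pHigh : pLow < pHigh
  pHigh_le_one : pHigh ≤ 1
  Θ : Set (EuclideanSpace ℝ (Fin d))
  A : Set ℝ
  A_nonneg : ∀ α ∈ A, 0 ≤ α

attribute [instance] PricingModel.isProb

namespace PricingModel

variable {d : ℕ}

/-- Baseline utility `xᵀθ` of a customer with context `x`. -/
def utility (x θ : EuclideanSpace ℝ (Fin d)) : ℝ := inner ℝ x θ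

/-- Expected demand `f(xᵀθ - αp)` for link function `f`. -/
def demand (f : ℝ → ℝ) (θ : EuclideanSpace ℝ (Fin d)) (α : ℝ)
    (x : EuclideanSpace ℝ (Fin d)) (p : ℝ) : ℝ := f (utility x θ - α * p)

/-- Expected revenue `r_u(p) = p f(u - αp)` at baseline utility `u` and price `p`. -/
def revenueAt (f : ℝ → ℝ) (α u p : ℝ) : ℝ := p * f (u - α * p)

/-- The covariance matrix `E[xxᵀ] - E[x]E[x]ᵀ` of the contexts. -/
def covMatrix (M : PricingModel d) : Matrix (Fin d) (Fin d) ℝ :=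
  Matrix.of fun i j =>
    (∫ x, x.1 i * x.1 j ∂M.P) - (∫ x, x.1 i ∂M.P) * (∫ x, x.1 j ∂M.P)

/-- Boundedness: utilities lie in the compact interval `[b₁, b₂] ⊆ [-B, B]`, net utilities lie in
`[-B', B']` and expected demands lie in `[0, 1]`. -/
def Boundedness (M : PricingModel d) (f : ℝ → ℝ) (B B' b₁ b₂ : ℝ) : Prop :=
  0 < B ∧ B ≤ B' ∧ -B ≤ b₁ ∧ b₁ ≤ b₂ ∧ b₂ ≤ B ∧
  ∀ x ∈ M.𝒳, ∀ p ∈ Icc M.pLow M.pHigh, ∀ θ ∈ M.Θ, ∀ α ∈ M.A,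
    utility x θ ∈ Icc b₁ b₂ ∧ utility x θ - α * p ∈ Icc (-B') B' ∧
    demand f θ α x p ∈ Icc (0 : ℝ) 1

/-- Smooth link and strongly unimodal revenue: `f` is `C²` with `|f|, |f'|, |f''| ≤ L` on
`[-B', B']`, and for all utilities in `[b₁, b₂]` the revenue is unimodal, with a strictly interior
maximizer from which it decays at least quadratically (so that the maximizer is unique). -/
def SmoothUnimodal (M : PricingModel d) (f : ℝ → ℝ) (B' b₁ b₂ L σ : ℝ) : Prop :=
  0 < σ ∧ ContDiff ℝ 2 f ∧
  (∀ u ∈ Icc (-B') B', |f u| ≤ L ∧ |deriv f u| ≤ L ∧ |deriv (deriv f) u| ≤ L) ∧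
  ∀ α ∈ M.A, ∀ u ∈ Icc b₁ b₂, ∃ p ∈ Ioo M.pLow M.pHigh,
    MonotoneOn (revenueAt f α u) (Icc M.pLow p) ∧
    AntitoneOn (revenueAt f α u) (Icc p M.pHigh) ∧
    ∀ p' ∈ Icc M.pLow M.pHigh,
      revenueAt f α u p' ≤ revenueAt f α u p - σ / 2 * (p' - p) ^ 2

/-- Stochastic contexts: `P[xᵀθ ∈ U] ≤ L |U| / (2B)` for measurable `U ⊆ [-B, B]`. -/
def StochasticContexts (M : PricingModel d) (B L : ℝ) : Prop :=
  ∀ θ ∈ M.Θ, ∀ U : Set ℝ, MeasurableSet U → U ⊆ Icc (-B) B →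
    M.P.real {x | utility x.1 θ ∈ U} ≤ L * volume.real U / (2 * B)

/-- Non-degenerate covariance: `λ_min(Cov(P)) ≥ σ > 0`, that is, `Cov(P) - σ I ⪰ 0`. -/
def CovNondegenerate (M : PricingModel d) (σ : ℝ) : Prop :=
  0 < σ ∧ MemLp (fun x : M.𝒳 => x.1) 2 M.P ∧
    (M.covMatrix - σ • (1 : Matrix (Fin d) (Fin d) ℝ)).PosSemidef

/-- All standing assumptions, with constants that are uniform over `Θ × A`. -/
def Assumptions (M : PricingModel d) (f : ℝ → ℝ) : Prop :=
  ∃ B B' b₁ b₂ Lf σr LU σx : ℝ,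
    M.Boundedness f B B' b₁ b₂ ∧ M.SmoothUnimodal f B' b₁ b₂ Lf σr ∧
    M.StochasticContexts B LU ∧ M.CovNondegenerate σx

/-- A (deterministic) contextual pricing policy `π : 𝒳 → [pLow, pHigh]`. -/
abbrev Policy (M : PricingModel d) : Type := M.𝒳 → Icc M.pLow M.pHigh

/-- The class of `δ`-utility-fair policies under the parameter `θ`
(fairness does not involve `α`). -/
def fairPolicies (M : PricingModel d) (θ : EuclideanSpace ℝ (Fin d)) (δ : ℝ) : Set M.Policy :=
  {π | ∀ x x' : M.𝒳, |(π x : ℝ) - (π x' : ℝ)| ≤ δ * |utility (x.1 - x'.1) θ|}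

/-- Expected revenue `R_{θ,α}(π) = E_{x ∼ P}[π(x) f(xᵀθ - απ(x))]` of a policy. -/
def revenue (M : PricingModel d) (f : ℝ → ℝ) (θ : EuclideanSpace ℝ (Fin d)) (α : ℝ)
    (π : M.Policy) : ℝ :=
  ∫ x, revenueAt f α (utility x.1 θ) (π x) ∂M.P

/-- `max_{π ∈ F_θ(δ)} R_{θ,α}(π)`, as a supremum of a nonempty bounded set of reals. -/
def optRevenue (M : PricingModel d) (f : ℝ → ℝ) (δ : ℝ) (θ : EuclideanSpace ℝ (Fin d))
    (α : ℝ) : ℝ :=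
  sSup (M.revenue f θ α '' M.fairPolicies θ δ)

/-- The optimal fair revenue is attained. -/
def HasOptimalFairPolicy (M : PricingModel d) (f : ℝ → ℝ) (δ : ℝ)
    (θ : EuclideanSpace ℝ (Fin d)) (α : ℝ) : Prop :=
  ∃ π ∈ M.fairPolicies θ δ, ∀ π' ∈ M.fairPolicies θ δ, M.revenue f θ α π' ≤ M.revenue f θ α π

/-- A learning algorithm with internal randomness `ω ∈ Ω`. The policy used in period `t`
(periods are numbered from `0`) is a function of `ω` and of the contexts and realized demands
of the periods before `t`; `true` stands for the demand `y = 1` and `false` for `y = 0`.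
The past prices are functions of the same data. Over `T` periods only `policy 0, …,
policy (T - 1)` are used. -/
structure Algorithm (M : PricingModel d) (Ω : Type*) [MeasurableSpace Ω] where
  policy : (t : ℕ) → Ω → (Fin t → M.𝒳 × Bool) → M.Policy
  measurable_policy : ∀ t : ℕ,
    Measurable fun z : Ω × (Fin t → M.𝒳 × Bool) × M.𝒳 => policy t z.1 z.2.1 z.2.2

/-- The sample space of an interaction: the algorithm's internal randomness and, for each period,
a context and a number in `[0, 1]`, which generates that period's demand. -/
abbrev Sample (M : PricingModel d) (Ω : Type*) : Type _ := Ω × (ℕ → M.𝒳 × unitInterval)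

/-- The probability on the sample space: internal randomness `ω ∼ ν`, contexts `xₜ ∼ P` and
`vₜ` uniform on `[0, 1]`, all independent. -/
def sampleLaw (M : PricingModel d) {Ω : Type*} [MeasurableSpace Ω] (ν : Measure Ω) :
    Measure (M.Sample Ω) :=
  ν.prod (Measure.infinitePi fun _ : ℕ => M.P.prod (volume : Measure unitInterval))

namespace Algorithm

variable {M : PricingModel d} {Ω : Type*} [MeasurableSpace Ω]

/-- The contexts and demands of the first `t` periods under the instance `(θ, α)`. In period `t`
the price is `πₜ(xₜ)`, and the demand is `yₜ = 1` exactly if `vₜ ≤ f(xₜᵀθ - απₜ(xₜ))`: as `vₜ` is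
uniform and independent of `xₜ` and of the past, `yₜ` is, given these, a Bernoulli variable of
mean `f(xₜᵀθ - απₜ(xₜ))` (see `demand_bernoulli`). -/
def history (𝒜 : M.Algorithm Ω) (f : ℝ → ℝ) (θ : EuclideanSpace ℝ (Fin d)) (α : ℝ)
    (z : M.Sample Ω) : (t : ℕ) → (Fin t → M.𝒳 × Bool)
  | 0 => Fin.elim0
  | t + 1 =>
    Fin.snoc (α := fun _ => M.𝒳 × Bool) (history 𝒜 f θ α z t)
      ((z.2 t).1,
        decide (((z.2 t).2 : ℝ) ≤
          demand f θ α (z.2 t).1 (𝒜.policy t z.1 (history 𝒜 f θ α z t) (z.2 t).1)))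

/-- The policy `πₜ` implemented in period `t` under the instance `(θ, α)`. -/
def played (𝒜 : M.Algorithm Ω) (f : ℝ → ℝ) (θ : EuclideanSpace ℝ (Fin d)) (α : ℝ) (t : ℕ)
    (z : M.Sample Ω) : M.Policy :=
  𝒜.policy t z.1 (𝒜.history f θ α z t)

/-- Under the instance `(θ, α)`, all policies of the first `T` periods are `δ`-utility fair with
probability at least `q`. (The event is not presupposed measurable: it is required to contain a
measurable event of probability at least `q`.) -/
def FairWithProb (𝒜 : M.Algorithm Ω) (f : ℝ → ℝ) (ν : Measure Ω) (T : ℕ) (δ q : ℝ)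
    (θ : EuclideanSpace ℝ (Fin d)) (α : ℝ) : Prop :=
  ∃ E : Set (M.Sample Ω), MeasurableSet E ∧
    E ⊆ {z | ∀ t < T, 𝒜.played f θ α t z ∈ M.fairPolicies θ δ} ∧
    q ≤ (M.sampleLaw ν).real E

/-- Expected cumulative regret over `T` periods under the instance `(θ, α)`, with respect to the
best `δ`-utility-fair policy. -/
def expectedRegret (𝒜 : M.Algorithm Ω) (f : ℝ → ℝ) (ν : Measure Ω) (T : ℕ) (δ : ℝ)
    (θ : EuclideanSpace ℝ (Fin d)) (α : ℝ) : ℝ :=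
  ∫ z, ∑ t ∈ Finset.range T,
    (M.optRevenue f δ θ α - M.revenue f θ α (𝒜.played f θ α t z)) ∂(M.sampleLaw ν)

/-- `sup_{(θ, α) ∈ Θ × A}` of the expected regret, in the extended reals. -/
def worstCaseRegret (𝒜 : M.Algorithm Ω) (f : ℝ → ℝ) (ν : Measure Ω) (T : ℕ) (δ : ℝ) : EReal :=
  ⨆ θ ∈ M.Θ, ⨆ α ∈ M.A, ((𝒜.expectedRegret f ν T δ θ α : ℝ) : EReal)

end Algorithm

/-- Thresholding a uniform variable at `q ∈ [0, 1]` gives a Bernoulli variable of mean `q`. -/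
theorem demand_bernoulli (q : ℝ) (hq : q ∈ Icc (0 : ℝ) 1) :
    (volume : Measure unitInterval).real {v | (v : ℝ) ≤ q} = q := by
  have : {v : unitInterval | (v : ℝ) ≤ q} = Iic (⟨q, hq⟩ : unitInterval) := by
    ext v; exact Iff.rfl
  rw [this, Measure.real, unitInterval.volume_Iic]
  simp [hq.1]

end PricingModel

end

/-! If the algorithm is fair with the required probability under every parameter, run it on two
instances `θ` and `θ'` with the same sample. In each period the demands differ with probability at
most `E‖x‖ * ‖θ - θ'‖`, so for `θ'` close to `θ` (depending on `T`) the two runs coincide with high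
probability, and the implemented policies are then fair under `θ` and under `θ'` at once. Fairness
is exact: it makes the price constant on the hyperplanes orthogonal to `θ`, and on those orthogonal
to `θ'`. If `θ'` is not a multiple of `θ`, the price is therefore constant on the whole convex
context space. For linear demand the unconstrained optimal price `xᵀθ / (2α)` is itself fair as
soon as `1 ≤ 2αδ`, and a constant price loses at least `Var(xᵀθ) / (4α)` against it in every
period. The regret is thus linear in `T`, which is more than `T ^ (2 / 3)`. -/

noncomputable section

open ProbabilityTheory
open scoped ENNReal InnerProductSpace Matrix symmDiff

section Probability

theorem measurePreserving_update {ι : Type*} [DecidableEq ι] {X : ι → Type*}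
    [∀ i, MeasurableSpace (X i)] (μ : ∀ i, Measure (X i)) [∀ i, IsProbabilityMeasure (μ i)]
    (i : ι) :
    MeasurePreserving (fun z : (∀ j, X j) × X i => Function.update z.1 i z.2)
      ((Measure.infinitePi μ).prod (μ i)) (Measure.infinitePi μ) := by
  refine ⟨measurable_update', Measure.eq_infinitePi _ fun s B hB => ?_⟩
  have preimage_eq : (fun z : (∀ j, X j) × X i => Function.update z.1 i z.2) ⁻¹' (s : Set ι).pi B =
      ((s.erase i : Finset ι) : Set ι).pi B ×ˢ (if i ∈ s then B i else univ) := by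
    ext ⟨z, x⟩
    by_cases hi : i ∈ s <;> grind [Function.update_self, Function.update_of_ne]
  rw [Measure.map_apply measurable_update' (.pi s.countable_toSet fun j _ => hB j), preimage_eq,
    Measure.prod_prod, Measure.infinitePi_pi _ fun j _ => hB j]
  split_ifs with hi
  · exact Finset.prod_erase_mul s (fun j => μ j (B j)) hi
  · rw [measure_univ, mul_one, Finset.erase_eq_of_notMem hi]

theorem volume_symmDiff_setOf_coe_le_le (a b : ℝ) :
    (volume : Measure unitInterval) ({v | (v : ℝ) ≤ a} ∆ {v | (v : ℝ) ≤ b}) ≤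
      ENNReal.ofReal |a - b| := by
  have image_subset : Subtype.val '' ({v : unitInterval | (v : ℝ) ≤ a} ∆ {v | (v : ℝ) ≤ b}) ⊆
      uIoc b a := by
    rintro _ ⟨v, hv, rfl⟩
    simp only [mem_symmDiff, mem_ofPred_eq] at hv
    grind [mem_uIoc]
  rw [unitInterval.volume_apply, ← Real.volume_uIoc]
  exact measure_mono image_subset

theorem isOpenPosMeasure_comap_coe {X : Type*} [TopologicalSpace X] [MeasurableSpace X]
    {μ : Measure X} [μ.IsOpenPosMeasure] {s : Set X} (hs : MeasurableSet s)
    (hs_closure : s ⊆ closure (interior s)) :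
    (μ.comap ((↑) : s → X)).IsOpenPosMeasure := by
  refine ⟨fun U hU ⟨x, hx⟩ measure_eq_zero => ?_⟩
  obtain ⟨V, hV, rfl⟩ := isOpen_induced_iff.1 hU
  rw [comap_subtype_coe_apply hs] at measure_eq_zero
  refine ((hV.inter isOpen_interior).measure_pos μ
    (mem_closure_iff.1 (hs_closure x.2) V hV hx)).ne' (measure_mono_null ?_ measure_eq_zero)
  exact fun y hy => ⟨⟨y, interior_subset hy.2⟩, hy.1, rfl⟩

instance isOpenPosMeasure_unitInterval : (volume : Measure unitInterval).IsOpenPosMeasure :=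
  isOpenPosMeasure_comap_coe measurableSet_Icc
    (by rw [unitInterval, interior_Icc, closure_Ioo zero_ne_one])

theorem integral_unitInterval_pow (n : ℕ) : ∫ w : unitInterval, (w : ℝ) ^ n = 1 / (n + 1) := by
  calc ∫ w : unitInterval, (w : ℝ) ^ n
      = ∫ r in Icc (0 : ℝ) 1, r ^ n :=
        unitInterval.measurePreserving_coe.integral_comp unitInterval.measurableEmbedding_coe _
    _ = ∫ r in (0 : ℝ)..1, r ^ n := by
        rw [integral_Icc_eq_integral_Ioc, intervalIntegral.integral_of_le zero_le_one]
    _ = 1 / (n + 1) := by simp [integral_pow]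

theorem memLp_unitInterval_coe (p : ℝ≥0∞) :
    MemLp (fun w : unitInterval => (w : ℝ)) p :=
  .of_bound (by fun_prop) 1 (.of_forall fun w => abs_le.2 ⟨by linarith [w.2.1], w.2.2⟩)

theorem variance_unitInterval_coe : Var[fun w : unitInterval => (w : ℝ)] = 1 / 12 := by
  have integral_coe := integral_unitInterval_pow 1
  have integral_sq := integral_unitInterval_pow 2
  simp only [pow_one] at integral_coe
  rw [variance_eq_sub (memLp_unitInterval_coe 2), integral_coe]
  simp only [Pi.pow_apply, integral_sq]
  norm_num

theorem covariance_pi {Ω ι : Type*} [MeasurableSpace Ω] [Fintype ι] [DecidableEq ι]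
    {μ : Measure Ω} [IsProbabilityMeasure μ] {X : Ω → ℝ} (hX : MemLp X 2 μ) (i j : ι) :
    cov[fun w : ι → Ω => X (w i), fun w => X (w j); Measure.pi fun _ => μ] =
      if i = j then Var[X; μ] else 0 := by
  have measurePreserving (k : ι) := measurePreserving_eval (fun _ : ι => μ) k
  have memLp (k : ι) : MemLp (fun w : ι → Ω => X (w k)) 2 (Measure.pi fun _ => μ) :=
    hX.comp_measurePreserving (measurePreserving k)
  split_ifs with hij
  · rw [← hij, covariance_self (memLp i).aemeasurable]
    exact (measurePreserving i).variance_fun_comp hX.aemeasurable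
  · exact ((iIndepFun_pi fun _ => hX.aemeasurable).indepFun hij).covariance_eq_zero
      (memLp i) (memLp j)

theorem volume_unitInterval_setOf_mul_add_mem_le {c : ℝ} (hc : c ≠ 0) (b : ℝ) (U : Set ℝ) :
    volume {w : unitInterval | c * w + b ∈ U} ≤ ENNReal.ofReal |c⁻¹| * volume U := by
  calc volume {w : unitInterval | c * w + b ∈ U}
      ≤ volume ((c * ·) ⁻¹' ((· + b) ⁻¹' U)) := by
        rw [unitInterval.volume_apply]
        exact measure_mono (image_subset_iff.2 fun _ hw => hw)
    _ = ENNReal.ofReal |c⁻¹| * volume U := by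
        rw [Real.volume_preimage_mul_left hc, measure_preimage_add_right]

theorem prod_setOf_mul_add_mem_le {Y : Type*} [MeasurableSpace Y] (ν : Measure Y)
    [IsProbabilityMeasure ν] {c : ℝ} (hc : c ≠ 0) {g : Y → ℝ} (hg : Measurable g) {U : Set ℝ}
    (hU : MeasurableSet U) :
    ((volume : Measure unitInterval).prod ν) {w | c * w.1 + g w.2 ∈ U} ≤
      ENNReal.ofReal |c⁻¹| * volume U := by
  have measurableSet : MeasurableSet {w : unitInterval × Y | c * w.1 + g w.2 ∈ U} :=
    hU.preimage (by fun_prop)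
  calc _ = ∫⁻ y, volume {w : unitInterval | c * w + g y ∈ U} ∂ν :=
        Measure.prod_apply_symm measurableSet
    _ ≤ ∫⁻ _, ENNReal.ofReal |c⁻¹| * volume U ∂ν :=
        lintegral_mono fun y => volume_unitInterval_setOf_mul_add_mem_le hc (g y) U
    _ = ENNReal.ofReal |c⁻¹| * volume U := by simp

end Probability

section Geometry

variable {E : Type*} [NormedAddCommGroup E] [InnerProductSpace ℝ E] {θ θ' : E}

theorem exists_inner_eq_zero_inner_eq_one (h : θ' ∉ ℝ ∙ θ) :
    ∃ w : E, ⟪w, θ⟫_ℝ = 0 ∧ ⟪w, θ'⟫_ℝ = 1 := by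
  rw [← Submodule.orthogonal_orthogonal (ℝ ∙ θ), Submodule.mem_orthogonal] at h
  push Not at h
  obtain ⟨w, hw, hwθ'⟩ := h
  refine ⟨(⟪w, θ'⟫_ℝ)⁻¹ • w, ?_, ?_⟩
  · rw [real_inner_smul_left, Submodule.mem_orthogonal_singleton_iff_inner_left.1 hw, mul_zero]
  · rw [real_inner_smul_left, inv_mul_cancel₀ hwθ']

theorem eq_of_eq_of_inner_eq {β : Type*} (h : θ' ∉ ℝ ∙ θ) {U : Set E} (hU : IsOpen U)
    (hU_conn : IsPreconnected U) {F : U → β}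
    (hθ : ∀ x y : U, ⟪(x : E), θ⟫_ℝ = ⟪(y : E), θ⟫_ℝ → F x = F y)
    (hθ' : ∀ x y : U, ⟪(x : E), θ'⟫_ℝ = ⟪(y : E), θ'⟫_ℝ → F x = F y) (x y : U) : F x = F y := by
  have := isPreconnected_iff_preconnectedSpace.1 hU_conn
  suffices IsLocallyConstant F from this.apply_eq_of_preconnectedSpace x y
  obtain ⟨w, hwθ, hwθ'⟩ := exists_inner_eq_zero_inner_eq_one h
  refine (IsLocallyConstant.iff_eventually_eq F).2 fun x => ?_
  -- `detour y` differs from `x` by a vector orthogonal to `θ`, and from `y` by one orthogonal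
  -- to `θ'`.
  let detour (y : U) : E := x + ⟪(y : E) - x, θ'⟫_ℝ • w
  have detour_continuous : Continuous detour := by fun_prop
  have detour_mem : ∀ᶠ y in nhds x, detour y ∈ U :=
    detour_continuous.continuousAt.eventually_mem (hU.mem_nhds (by simp [detour]))
  filter_upwards [detour_mem] with y hy
  calc F y = F ⟨detour y, hy⟩ :=
        hθ' _ _ (by simp [detour, inner_add_left, inner_sub_left, real_inner_smul_left, hwθ'])
    _ = F x := hθ _ _ (by simp [detour, inner_add_left, real_inner_smul_left, hwθ])

theorem eq_of_lipschitz_of_inner {X : Type*} [MetricSpace X] (h : θ' ∉ ℝ ∙ θ) {s : Set E}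
    (hs : Convex ℝ s) (hs_int : (interior s).Nonempty) {F : s → X} {δ : ℝ}
    (hθ : ∀ x y : s, dist (F x) (F y) ≤ δ * |⟪(x : E) - y, θ⟫_ℝ|)
    (hθ' : ∀ x y : s, dist (F x) (F y) ≤ δ * |⟪(x : E) - y, θ'⟫_ℝ|) (x y : s) : F x = F y := by
  have hF : Continuous F := by
    refine continuous_iff_continuousAt.2 fun x => tendsto_iff_dist_tendsto_zero.2 ?_
    refine squeeze_zero (fun _ => dist_nonneg) (fun y => hθ y x) ?_
    exact Continuous.tendsto' (by fun_prop) _ _ (by simp)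
  have eq_of_inner_eq {ϑ : E} (hϑ : ∀ x y : s, dist (F x) (F y) ≤ δ * |⟪(x : E) - y, ϑ⟫_ℝ|)
      (x y : s) (hxy : ⟪(x : E), ϑ⟫_ℝ = ⟪(y : E), ϑ⟫_ℝ) : F x = F y :=
    dist_le_zero.1 ((hϑ x y).trans_eq (by rw [inner_sub_left, hxy, sub_self, abs_zero, mul_zero]))
  have eq_on_interior (x y : interior s) :
      F (inclusion interior_subset x) = F (inclusion interior_subset y) :=
    eq_of_eq_of_inner_eq (F := fun z => F (inclusion interior_subset z)) h isOpen_interior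
      hs.interior.isPreconnected (fun _ _ hxy => eq_of_inner_eq hθ _ _ hxy)
      (fun _ _ hxy => eq_of_inner_eq hθ' _ _ hxy) x y
  have dense_interior : Dense (Subtype.val ⁻¹' interior s : Set s) := by
    rw [Subtype.dense_iff, Subtype.image_preimage_coe,
      inter_eq_self_of_subset_right interior_subset,
      hs.closure_interior_eq_closure_of_nonempty_interior hs_int]
    exact subset_closure
  obtain ⟨z, hz⟩ := hs_int
  have eq_const : F = fun _ => F ⟨z, interior_subset hz⟩ :=
    hF.ext_on dense_interior continuous_const fun x hx => eq_on_interior ⟨x, hx⟩ ⟨z, hz⟩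
  rw [eq_const]

end Geometry

namespace PricingModel

variable {d : ℕ} {M : PricingModel d} {Ω : Type*} [MeasurableSpace Ω]

instance isProbabilityMeasure_sampleLaw (ν : Measure Ω) [IsProbabilityMeasure ν] :
    IsProbabilityMeasure (M.sampleLaw ν) := by
  unfold sampleLaw
  infer_instance

theorem measurePreserving_update_period (ν : Measure Ω) [IsProbabilityMeasure ν] (t : ℕ) :
    MeasurePreserving
      (fun w : M.Sample Ω × M.𝒳 × unitInterval => (w.1.1, Function.update w.1.2 t w.2))
      ((M.sampleLaw ν).prod (M.P.prod volume)) (M.sampleLaw ν) :=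
  ((MeasurePreserving.id ν).prod (measurePreserving_update _ t)).comp
    (measurePreserving_prodAssoc ν _ _)

theorem continuous_utility (θ : EuclideanSpace ℝ (Fin d)) :
    Continuous fun x : EuclideanSpace ℝ (Fin d) => utility x θ := by
  unfold utility
  fun_prop

theorem measurable_utility (θ : EuclideanSpace ℝ (Fin d)) :
    Measurable fun x : M.𝒳 => utility x.1 θ :=
  (continuous_utility θ).measurable.comp measurable_subtype_coe

theorem measurable_demand_comp {Z : Type*} [MeasurableSpace Z] {f : ℝ → ℝ} (hf : Measurable f)
    (θ : EuclideanSpace ℝ (Fin d)) (α : ℝ) {x : Z → M.𝒳} {p : Z → ℝ} (hx : Measurable x)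
    (hp : Measurable p) : Measurable fun z => demand f θ α (x z) (p z) :=
  hf.comp (((measurable_utility θ).comp hx).sub (hp.const_mul α))

theorem measurable_context (t : ℕ) : Measurable fun z : M.Sample Ω => (z.2 t).1 := by
  fun_prop

namespace Algorithm

variable (𝒜 : M.Algorithm Ω) {f : ℝ → ℝ}

theorem history_update (f : ℝ → ℝ) (θ : EuclideanSpace ℝ (Fin d)) (α : ℝ) (z : M.Sample Ω)
    (y : M.𝒳 × unitInterval) {t n : ℕ} (htn : t ≤ n) :
    𝒜.history f θ α (z.1, Function.update z.2 n y) t = 𝒜.history f θ α z t := by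
  induction t with
  | zero => rfl
  | succ t ih => simp only [history, ih (by omega), Function.update_of_ne (by omega : t ≠ n)]

section Measurability

theorem measurable_policy_comp {Z : Type*} [MeasurableSpace Z] {t : ℕ} {ω : Z → Ω}
    {h : Z → Fin t → M.𝒳 × Bool} {x : Z → M.𝒳} (hω : Measurable ω) (hh : Measurable h)
    (hx : Measurable x) : Measurable fun z => ((𝒜.policy t (ω z) (h z) (x z) : ℝ)) :=
  measurable_subtype_coe.comp ((𝒜.measurable_policy t).comp (hω.prodMk (hh.prodMk hx)))

theorem measurable_history (hf : Measurable f) (θ : EuclideanSpace ℝ (Fin d)) (α : ℝ) (t : ℕ) :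
    Measurable fun z : M.Sample Ω => 𝒜.history f θ α z t := by
  induction t with
  | zero => exact measurable_const
  | succ t ih =>
    have hv : Measurable fun z : M.Sample Ω => ((z.2 t).2 : ℝ) := by fun_prop
    have hp := 𝒜.measurable_policy_comp measurable_fst ih (measurable_context t)
    refine measurable_pi_iff.2 fun i => ?_
    induction i using Fin.lastCases with
    | last =>
      simp only [history, Fin.snoc_last]
      refine (measurable_context t).prodMk (measurable_to_bool ?_)
      simpa only [preimage, mem_singleton_iff, decide_eq_true_eq] using measurableSet_le hv
        (measurable_demand_comp hf θ α (measurable_context t) hp)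
    | cast i =>
      simp only [history, Fin.snoc_castSucc]
      exact (measurable_pi_apply i).comp ih

theorem measurable_revenue_played (hf : Measurable f) (θ : EuclideanSpace ℝ (Fin d)) (α : ℝ)
    (t : ℕ) : Measurable fun z : M.Sample Ω => M.revenue f θ α (𝒜.played f θ α t z) := by
  have hp : Measurable fun w : M.Sample Ω × M.𝒳 => (𝒜.played f θ α t w.1 w.2 : ℝ) :=
    𝒜.measurable_policy_comp (by fun_prop) ((𝒜.measurable_history hf θ α t).comp measurable_fst)
      measurable_snd
  exact (hp.mul (measurable_demand_comp hf θ α measurable_snd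
    hp)).stronglyMeasurable.integral_prod_right'.measurable

end Measurability

/-- The event that in period `t` a customer who behaves according to `(θ', α')` buys at the price
which the algorithm sets under the instance `(θ, α)`. -/
def purchase (f : ℝ → ℝ) (θ : EuclideanSpace ℝ (Fin d)) (α : ℝ)
    (θ' : EuclideanSpace ℝ (Fin d)) (α' : ℝ) (t : ℕ) : Set (M.Sample Ω) :=
  {z | ((z.2 t).2 : ℝ) ≤ demand f θ' α' (z.2 t).1 (𝒜.played f θ α t z (z.2 t).1)}

/-- The event that in period `t`, at the price set under the instance `(θ, α)`, the coupled demands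
of `(θ, α)` and `(θ', α')` differ. Off these events both instances generate the same history. -/
def disagreement (f : ℝ → ℝ) (θ : EuclideanSpace ℝ (Fin d)) (α : ℝ)
    (θ' : EuclideanSpace ℝ (Fin d)) (α' : ℝ) (t : ℕ) : Set (M.Sample Ω) :=
  𝒜.purchase f θ α θ α t ∆ 𝒜.purchase f θ α θ' α' t

variable {θ θ' : EuclideanSpace ℝ (Fin d)} {α α' : ℝ}

theorem measurableSet_disagreement (hf : Measurable f) (t : ℕ) :
    MeasurableSet (𝒜.disagreement f θ α θ' α' t) := by
  have measurableSet_purchase (ϑ : EuclideanSpace ℝ (Fin d)) (a : ℝ) :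
      MeasurableSet (𝒜.purchase f θ α ϑ a t) :=
    measurableSet_le (by fun_prop) <| measurable_demand_comp hf ϑ a (measurable_context t) <|
      𝒜.measurable_policy_comp measurable_fst (𝒜.measurable_history hf θ α t)
        (measurable_context t)
  exact (measurableSet_purchase θ α).symmDiff (measurableSet_purchase θ' α')

theorem history_eq_of_notMem_disagreement {z : M.Sample Ω} {t : ℕ}
    (hz : ∀ s < t, z ∉ 𝒜.disagreement f θ α θ' α' s) :
    𝒜.history f θ α z t = 𝒜.history f θ' α' z t := by
  induction t with
  | zero => rfl
  | succ t ih =>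
    have history_eq := ih fun s hs => hz s (by omega)
    have same_demand := hz t t.lt_succ_self
    simp only [disagreement, purchase, played, mem_symmDiff, mem_ofPred_eq] at same_demand
    simp only [history]
    rw [history_eq] at same_demand ⊢
    congr 3
    exact propext (by tauto)

theorem sampleLaw_disagreement_le (hf : Measurable f) (ν : Measure Ω) [IsProbabilityMeasure ν]
    {g : M.𝒳 → ℝ} (hg : Integrable g M.P) (hfg : ∀ (x : M.𝒳) (p : Icc M.pLow M.pHigh),
      |demand f θ α x p - demand f θ' α' x p| ≤ g x) (t : ℕ) :
    (M.sampleLaw ν).real (𝒜.disagreement f θ α θ' α' t) ≤ ∫ x, g x ∂M.P := by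
  have hg₀ (x : M.𝒳) : 0 ≤ g x :=
    (abs_nonneg _).trans (hfg x ⟨M.pLow, left_mem_Icc.2 M.pLow_lt_pHigh.le⟩)
  refine ENNReal.toReal_le_of_le_ofReal (integral_nonneg hg₀) ?_
  have hD := 𝒜.measurableSet_disagreement (θ := θ) (θ' := θ') (α := α) (α' := α') hf t
  have hup := measurePreserving_update_period (M := M) ν t
  -- The price of period `t` does not depend on the sample of period `t`, which we may redraw.
  have conditional_le (z : M.Sample Ω) : (M.P.prod (volume : Measure unitInterval))
      ((fun y => (z.1, Function.update z.2 t y)) ⁻¹' 𝒜.disagreement f θ α θ' α' t) ≤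
        ENNReal.ofReal (∫ x, g x ∂M.P) := by
    have redraw_measurable : Measurable fun y : M.𝒳 × unitInterval =>
        (z.1, Function.update z.2 t y) := hup.measurable.comp measurable_prodMk_left
    rw [Measure.prod_apply (redraw_measurable hD),
      ofReal_integral_eq_lintegral_ofReal hg (.of_forall hg₀)]
    refine lintegral_mono fun x => (measure_mono ?_).trans <|
      (volume_symmDiff_setOf_coe_le_le _ _).trans
        (ENNReal.ofReal_le_ofReal (hfg x (𝒜.played f θ α t z x)))
    intro v hv
    simpa only [disagreement, purchase, played, mem_preimage, mem_symmDiff, mem_ofPred_eq,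
      Function.update_self, 𝒜.history_update f θ α z _ le_rfl] using hv
  rw [← hup.measure_preimage hD.nullMeasurableSet, Measure.prod_apply (hup.measurable hD)]
  calc _ ≤ ∫⁻ _, ENNReal.ofReal (∫ x, g x ∂M.P) ∂(M.sampleLaw ν) :=
        lintegral_mono conditional_le
    _ = _ := by simp

theorem exists_fair_under_both (hf : Measurable f) (ν : Measure Ω) [IsProbabilityMeasure ν]
    {g : M.𝒳 → ℝ} (hg : Integrable g M.P) (hfg : ∀ (x : M.𝒳) (p : Icc M.pLow M.pHigh),
      |demand f θ α x p - demand f θ' α' x p| ≤ g x) {δ q : ℝ} {T : ℕ}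
    (h : 𝒜.FairWithProb f ν T δ q θ α) (h' : 𝒜.FairWithProb f ν T δ q θ' α') :
    ∃ E : Set (M.Sample Ω), MeasurableSet E ∧
      2 * q - 1 - T * ∫ x, g x ∂M.P ≤ (M.sampleLaw ν).real E ∧
      ∀ z ∈ E, ∀ t < T, 𝒜.played f θ α t z ∈ M.fairPolicies θ δ ∩ M.fairPolicies θ' δ := by
  obtain ⟨E, hE, hE_fair, hqE⟩ := h
  obtain ⟨E', hE', hE'_fair, hqE'⟩ := h'
  let S : Set (M.Sample Ω) := ⋃ t ∈ Finset.range T, 𝒜.disagreement f θ α θ' α' t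
  have hS : MeasurableSet S :=
    Finset.measurableSet_biUnion _ fun t _ => 𝒜.measurableSet_disagreement hf t
  have measure_S_le : (M.sampleLaw ν).real S ≤ T * ∫ x, g x ∂M.P :=
    calc (M.sampleLaw ν).real S
        ≤ ∑ t ∈ Finset.range T, (M.sampleLaw ν).real (𝒜.disagreement f θ α θ' α' t) :=
          measureReal_biUnion_finset_le _ _
      _ ≤ ∑ _t ∈ Finset.range T, ∫ x, g x ∂M.P :=
          Finset.sum_le_sum fun t _ => 𝒜.sampleLaw_disagreement_le hf ν hg hfg t
      _ = T * ∫ x, g x ∂M.P := by simp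
  refine ⟨(E ∩ E') \ S, (hE.inter hE').diff hS, ?_, ?_⟩
  · have union_add_inter := measureReal_union_add_inter (μ := M.sampleLaw ν) (s := E) hE'
    have union_le : (M.sampleLaw ν).real (E ∪ E') ≤ 1 := measureReal_le_one
    have le_diff := le_measureReal_sdiff (μ := M.sampleLaw ν) (s₁ := E ∩ E') (measure_ne_top _ S)
    linarith
  · rintro z ⟨⟨hzE, hzE'⟩, hzS⟩ t ht
    have history_eq : 𝒜.history f θ α z t = 𝒜.history f θ' α' z t :=
      𝒜.history_eq_of_notMem_disagreement fun s hs hmem =>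
        hzS (mem_biUnion (Finset.mem_coe.2 (Finset.mem_range.2 (hs.trans ht))) hmem)
    refine ⟨hE_fair hzE t ht, ?_⟩
    rw [played, history_eq]
    exact hE'_fair hzE' t ht

theorem integrable_regret (hf : Measurable f) (ν : Measure Ω) [IsProbabilityMeasure ν] {K δ : ℝ}
    (hK : ∀ π : M.Policy, K ≤ M.revenue f θ α π)
    (hopt : ∀ π : M.Policy, M.revenue f θ α π ≤ M.optRevenue f δ θ α) (t : ℕ) :
    Integrable (fun z => M.optRevenue f δ θ α - M.revenue f θ α (𝒜.played f θ α t z))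
      (M.sampleLaw ν) := by
  refine Integrable.of_bound (C := M.optRevenue f δ θ α - K)
    (measurable_const.sub (𝒜.measurable_revenue_played hf θ α t)).aestronglyMeasurable
    (.of_forall fun z => ?_)
  rw [Real.norm_of_nonneg (sub_nonneg.2 (hopt _))]
  exact sub_le_sub_left (hK _) _

theorem le_expectedRegret (hf : Measurable f) (ν : Measure Ω) [IsProbabilityMeasure ν]
    {g : M.𝒳 → ℝ} (hg : Integrable g M.P) (hfg : ∀ (x : M.𝒳) (p : Icc M.pLow M.pHigh),
      |demand f θ α x p - demand f θ' α' x p| ≤ g x) {δ q κ K : ℝ} {T : ℕ}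
    (h : 𝒜.FairWithProb f ν T δ q θ α) (h' : 𝒜.FairWithProb f ν T δ q θ' α')
    (hK : ∀ π : M.Policy, K ≤ M.revenue f θ α π)
    (hopt : ∀ π : M.Policy, M.revenue f θ α π ≤ M.optRevenue f δ θ α) (hκ₀ : 0 ≤ κ)
    (hκ : ∀ π ∈ M.fairPolicies θ δ ∩ M.fairPolicies θ' δ,
      κ ≤ M.optRevenue f δ θ α - M.revenue f θ α π) :
    (2 * q - 1 - T * ∫ x, g x ∂M.P) * (T * κ) ≤ 𝒜.expectedRegret f ν T δ θ α := by
  obtain ⟨E, hE, hqE, hE_fair⟩ := 𝒜.exists_fair_under_both hf ν hg hfg h h'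
  let regret (z : M.Sample Ω) : ℝ :=
    ∑ t ∈ Finset.range T, (M.optRevenue f δ θ α - M.revenue f θ α (𝒜.played f θ α t z))
  have indicator_le (z : M.Sample Ω) : E.indicator (fun _ => T * κ) z ≤ regret z := by
    refine indicator_le' (fun z hz => ?_) (fun z _ => ?_) z
    · calc (T * κ : ℝ) = ∑ _t ∈ Finset.range T, κ := by simp
        _ ≤ regret z :=
          Finset.sum_le_sum fun t ht => hκ _ (hE_fair z hz t (Finset.mem_range.1 ht))
    · exact Finset.sum_nonneg fun t _ => sub_nonneg.2 (hopt _)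
  calc (2 * q - 1 - T * ∫ x, g x ∂M.P) * (T * κ)
      ≤ (M.sampleLaw ν).real E * (T * κ) := by gcongr
    _ = ∫ z, E.indicator (fun _ => T * κ) z ∂(M.sampleLaw ν) := by
      rw [integral_indicator hE, setIntegral_const, smul_eq_mul]
    _ ≤ 𝒜.expectedRegret f ν T δ θ α :=
      integral_mono ((integrable_const _).indicator hE)
        (integrable_finsetSum _ fun t _ => 𝒜.integrable_regret hf ν hK hopt t) indicator_le

end Algorithm

theorem policy_eq_of_mem_fairPolicies_inter (h𝒳 : Convex ℝ M.𝒳) (h𝒳_int : (interior M.𝒳).Nonempty)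
    {θ θ' : EuclideanSpace ℝ (Fin d)} (h : θ' ∉ ℝ ∙ θ) {δ : ℝ} {π : M.Policy}
    (hπ : π ∈ M.fairPolicies θ δ ∩ M.fairPolicies θ' δ) (x y : M.𝒳) : π x = π y :=
  eq_of_lipschitz_of_inner h h𝒳 h𝒳_int (fun x y => hπ.1 x y) (fun x y => hπ.2 x y) x y

section LinearDemand

variable {θ θ' : EuclideanSpace ℝ (Fin d)} {α δ B B' b₁ b₂ L σr σ : ℝ}

theorem revenueAt_linear (hα : α ≠ 0) (u p : ℝ) :
    revenueAt (fun u => u) α u p = u ^ 2 / (4 * α) - α * (p - u / (2 * α)) ^ 2 := by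
  unfold revenueAt
  field_simp
  ring

theorem revenueAt_linear_le (hα : 0 < α) (u p : ℝ) :
    revenueAt (fun u => u) α u p ≤ u ^ 2 / (4 * α) := by
  rw [revenueAt_linear hα.ne']
  exact sub_le_self _ (by positivity)

theorem smoothUnimodal_linear (hσ : 0 < σ) (hB' : B' ≤ L) (hL : 1 ≤ L)
    (hA : ∀ α ∈ M.A, σ ≤ 2 * α)
    (hp : ∀ α ∈ M.A, ∀ u ∈ Icc b₁ b₂, u / (2 * α) ∈ Ioo M.pLow M.pHigh) :
    M.SmoothUnimodal (fun u => u) B' b₁ b₂ L σ := by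
  refine ⟨hσ, contDiff_id, fun u hu => ?_, fun α hα u hu => ?_⟩
  · simp only [deriv_id'', deriv_const, abs_one, abs_zero]
    exact ⟨(abs_le.2 hu).trans hB', hL, by linarith⟩
  · have hα₀ : 0 < α := by linarith [hA α hα]
    simp only [MonotoneOn, AntitoneOn, revenueAt_linear hα₀.ne']
    refine ⟨u / (2 * α), hp α hα u hu, fun p _ p' hp' hpp' => ?_, fun p hp p' _ hpp' => ?_,
      fun p' _ => ?_⟩
    · gcongr _ - _ * ?_
      nlinarith [hp'.2]
    · gcongr _ - _ * ?_
      nlinarith [hp.1]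
    · nlinarith [hA α hα, sq_nonneg (p' - u / (2 * α))]

theorem SmoothUnimodal.optimal_price_mem_Ioo (h : M.SmoothUnimodal (fun u => u) B' b₁ b₂ L σ)
    (hα : α ∈ M.A) (hα₀ : α ≠ 0) {u : ℝ} (hu : u ∈ Icc b₁ b₂) :
    u / (2 * α) ∈ Ioo M.pLow M.pHigh := by
  obtain ⟨p, hp, -, -, hp_max⟩ := h.2.2.2 α hα u hu
  have isLocalMax : IsLocalMax (revenueAt (fun u => u) α u) p := by
    filter_upwards [Icc_mem_nhds hp.1 hp.2] with p' hp'
    nlinarith [hp_max p' hp', h.1, sq_nonneg (p' - p)]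
  have hasDerivAt : HasDerivAt (revenueAt (fun u => u) α u) (u - 2 * α * p) p := by
    refine ((hasDerivAt_id p).mul (((hasDerivAt_id p).const_mul α).const_sub u)).congr_deriv ?_
    simp only [id_eq]
    ring
  have price_eq : u / (2 * α) = p := by
    rw [div_eq_iff (by positivity)]
    linarith [isLocalMax.hasDerivAt_eq_zero hasDerivAt]
  rwa [price_eq]

theorem revenueAt_nonneg {f : ℝ → ℝ} (h : M.Boundedness f B B' b₁ b₂) (hθ : θ ∈ M.Θ)
    (hα : α ∈ M.A) (x : M.𝒳) (p : Icc M.pLow M.pHigh) :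
    0 ≤ revenueAt f α (utility x.1 θ) p :=
  mul_nonneg (M.pLow_nonneg.trans p.2.1) (h.2.2.2.2.2 x x.2 p p.2 θ hθ α hα).2.2.1

theorem revenue_nonneg {f : ℝ → ℝ} (h : M.Boundedness f B B' b₁ b₂) (hθ : θ ∈ M.Θ)
    (hα : α ∈ M.A) (π : M.Policy) : 0 ≤ M.revenue f θ α π :=
  integral_nonneg fun x => revenueAt_nonneg h hθ hα x (π x)

theorem memLp_utility (hM : MemLp (fun x : M.𝒳 => x.1) 2 M.P) (θ : EuclideanSpace ℝ (Fin d)) :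
    MemLp (fun x : M.𝒳 => utility x.1 θ) 2 M.P :=
  hM.inner_const θ

theorem revenue_linear_le (h : M.Boundedness (fun u => u) B B' b₁ b₂)
    (hM : MemLp (fun x : M.𝒳 => x.1) 2 M.P) (hθ : θ ∈ M.Θ) (hα : α ∈ M.A) (hα₀ : 0 < α)
    (π : M.Policy) :
    M.revenue (fun u => u) θ α π ≤ ∫ x, utility x.1 θ ^ 2 / (4 * α) ∂M.P :=
  integral_mono_of_nonneg (.of_forall fun x => revenueAt_nonneg h hθ hα x (π x))
    ((memLp_utility hM θ).integrable_sq.div_const _)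
    (.of_forall fun _ => revenueAt_linear_le hα₀ _ _)

theorem isGreatest_revenue_linear (h : M.Boundedness (fun u => u) B B' b₁ b₂)
    (hr : M.SmoothUnimodal (fun u => u) B' b₁ b₂ L σ) (hM : MemLp (fun x : M.𝒳 => x.1) 2 M.P)
    (hθ : θ ∈ M.Θ) (hα : α ∈ M.A) (hα₀ : 0 < α) (hδ : 1 ≤ 2 * α * δ) :
    IsGreatest (M.revenue (fun u => u) θ α '' M.fairPolicies θ δ)
      (∫ x, utility x.1 θ ^ 2 / (4 * α) ∂M.P) := by
  have utility_mem (x : M.𝒳) : utility x.1 θ ∈ Icc b₁ b₂ :=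
    (h.2.2.2.2.2 x x.2 M.pLow (left_mem_Icc.2 M.pLow_lt_pHigh.le) θ hθ α hα).1
  let optimal : M.Policy := fun x => ⟨utility x.1 θ / (2 * α),
    Ioo_subset_Icc_self (hr.optimal_price_mem_Ioo hα hα₀.ne' (utility_mem x))⟩
  refine ⟨⟨optimal, fun x y => ?_, integral_congr_ae (.of_forall fun x => ?_)⟩, ?_⟩
  · calc |utility x.1 θ / (2 * α) - utility y.1 θ / (2 * α)|
        = 1 / (2 * α) * |utility (x.1 - y.1) θ| := by
          rw [← sub_div, abs_div, abs_of_pos (by positivity : 0 < 2 * α), utility, utility, utility,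
            inner_sub_left, one_div_mul_eq_div]
      _ ≤ δ * |utility (x.1 - y.1) θ| := by
          gcongr
          rw [div_le_iff₀ (by positivity)]
          linarith
  · simp only [optimal, revenueAt_linear hα₀.ne']
    ring
  · rintro _ ⟨π, -, rfl⟩
    exact revenue_linear_le h hM hθ hα hα₀ π

theorem hasOptimalFairPolicy_linear (h : M.Boundedness (fun u => u) B B' b₁ b₂)
    (hr : M.SmoothUnimodal (fun u => u) B' b₁ b₂ L σ) (hM : MemLp (fun x : M.𝒳 => x.1) 2 M.P)
    (hθ : θ ∈ M.Θ) (hα : α ∈ M.A) (hα₀ : 0 < α) (hδ : 1 ≤ 2 * α * δ) :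
    M.HasOptimalFairPolicy (fun u => u) δ θ α := by
  obtain ⟨⟨π, hπ, revenue_eq⟩, is_max⟩ := isGreatest_revenue_linear h hr hM hθ hα hα₀ hδ
  exact ⟨π, hπ, fun π' hπ' => (is_max ⟨π', hπ', rfl⟩).trans_eq revenue_eq.symm⟩

theorem variance_div_le_of_const (hM : MemLp (fun x : M.𝒳 => x.1) 2 M.P) (hα : 0 < α)
    {π : M.Policy} (hπ : ∀ x y, π x = π y) :
    Var[fun x : M.𝒳 => utility x.1 θ; M.P] / (4 * α) ≤
      (∫ x, utility x.1 θ ^ 2 / (4 * α) ∂M.P) - M.revenue (fun u => u) θ α π := by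
  have hu := memLp_utility hM θ
  have x₀ : M.𝒳 := M.P.nonempty_of_neZero.some
  have revenue_eq : M.revenue (fun u => u) θ α π =
      revenueAt (fun u => u) α (∫ x, utility x.1 θ ∂M.P) (π x₀) := by
    simp only [revenue, revenueAt, hπ _ x₀]
    rw [integral_const_mul, integral_sub (hu.integrable one_le_two) (integrable_const _),
      integral_const, probReal_univ, one_smul]
  rw [revenue_eq, variance_eq_sub hu, integral_div, sub_div]
  exact sub_le_sub_left (revenueAt_linear_le hα _ _) _

theorem covMatrix_apply (hM : MemLp (fun x : M.𝒳 => x.1) 2 M.P) (i j : Fin d) :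
    M.covMatrix i j = cov[fun x : M.𝒳 => x.1 i, fun x : M.𝒳 => x.1 j; M.P] :=
  (covariance_eq_sub (hM.eval_piLp i) (hM.eval_piLp j)).symm

theorem variance_utility (hM : MemLp (fun x : M.𝒳 => x.1) 2 M.P)
    (θ : EuclideanSpace ℝ (Fin d)) :
    Var[fun x : M.𝒳 => utility x.1 θ; M.P] = θ ⬝ᵥ M.covMatrix *ᵥ θ := by
  have utility_eq (x : M.𝒳) : utility x.1 θ = ∑ i, θ i * x.1 i := by
    simp [utility, PiLp.inner_apply]
  have hMi (i : Fin d) := (hM.eval_piLp i).const_mul (θ i)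
  simp only [utility_eq]
  rw [← covariance_self (memLp_finsetSum _ fun i _ => hMi i).aemeasurable,
    covariance_fun_sum_fun_sum hMi hMi]
  simp only [covariance_const_mul_left, covariance_const_mul_right, ← covMatrix_apply hM,
    dotProduct, Matrix.mulVec, Finset.mul_sum]
  exact Finset.sum_congr rfl fun i _ => Finset.sum_congr rfl fun j _ => by ring

theorem CovNondegenerate.le_variance_utility (h : M.CovNondegenerate σ)
    (θ : EuclideanSpace ℝ (Fin d)) :
    σ * ‖θ‖ ^ 2 ≤ Var[fun x : M.𝒳 => utility x.1 θ; M.P] := by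
  have sub_nonneg := h.2.2.dotProduct_mulVec_nonneg θ
  have norm_sq : θ ⬝ᵥ θ = ‖θ‖ ^ 2 := by
    rw [EuclideanSpace.real_norm_sq_eq]
    exact Finset.sum_congr rfl fun i _ => (sq (θ i)).symm
  rw [star_trivial, Matrix.sub_mulVec, Matrix.smul_mulVec, Matrix.one_mulVec, dotProduct_sub,
    dotProduct_smul, norm_sq, smul_eq_mul] at sub_nonneg
  rw [variance_utility h.2.1]
  linarith

theorem abs_demand_linear_sub_le (θ θ' : EuclideanSpace ℝ (Fin d)) (α : ℝ)
    (x : EuclideanSpace ℝ (Fin d)) (p : ℝ) :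
    |demand (fun u => u) θ α x p - demand (fun u => u) θ' α x p| ≤ ‖x‖ * ‖θ - θ'‖ := by
  rw [demand, demand, sub_sub_sub_cancel_right, utility, utility, ← inner_sub_right]
  exact abs_real_inner_le_norm x _

theorem le_expectedRegret_of_notMem_span (h𝒳 : Convex ℝ M.𝒳) (h𝒳_int : (interior M.𝒳).Nonempty)
    (h : M.Boundedness (fun u => u) B B' b₁ b₂)
    (hr : M.SmoothUnimodal (fun u => u) B' b₁ b₂ L σr) (hM : M.CovNondegenerate σ)
    (hθ : θ ∈ M.Θ) (hα : α ∈ M.A) (hα₀ : 0 < α) (hδ : 1 ≤ 2 * α * δ) (hθ' : θ' ∉ ℝ ∙ θ)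
    (ν : Measure Ω) [IsProbabilityMeasure ν] (𝒜 : M.Algorithm Ω) {T : ℕ} {q : ℝ}
    (hfair : 𝒜.FairWithProb (fun u => u) ν T δ q θ α)
    (hfair' : 𝒜.FairWithProb (fun u => u) ν T δ q θ' α) :
    (2 * q - 1 - T * ∫ x : M.𝒳, ‖x.1‖ * ‖θ - θ'‖ ∂M.P) * (T * (σ * ‖θ‖ ^ 2 / (4 * α))) ≤
      𝒜.expectedRegret (fun u => u) ν T δ θ α := by
  have opt_eq : M.optRevenue (fun u => u) δ θ α = ∫ x, utility x.1 θ ^ 2 / (4 * α) ∂M.P :=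
    (isGreatest_revenue_linear h hr hM.2.1 hθ hα hα₀ hδ).csSup_eq
  refine 𝒜.le_expectedRegret measurable_id ν ((hM.2.1.integrable one_le_two).norm.mul_const _)
    (fun x p => abs_demand_linear_sub_le θ θ' α x p) hfair hfair'
    (revenue_nonneg h hθ hα) (fun π => ?_) ?_ (fun π hπ => ?_)
  · exact opt_eq ▸ revenue_linear_le h hM.2.1 hθ hα hα₀ π
  · have := hM.1
    positivity
  · calc σ * ‖θ‖ ^ 2 / (4 * α)
        ≤ Var[fun x : M.𝒳 => utility x.1 θ; M.P] / (4 * α) := by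
          gcongr
          exact hM.le_variance_utility θ
      _ ≤ M.optRevenue (fun u => u) δ θ α - M.revenue (fun u => u) θ α π := by
          rw [opt_eq]
          exact variance_div_le_of_const hM.2.1 hα₀
            (policy_eq_of_mem_fairPolicies_inter h𝒳 h𝒳_int hθ' hπ)

theorem linear_le_expectedRegret (h𝒳 : Convex ℝ M.𝒳) (h𝒳_int : (interior M.𝒳).Nonempty)
    (h : M.Boundedness (fun u => u) B B' b₁ b₂)
    (hr : M.SmoothUnimodal (fun u => u) B' b₁ b₂ L σr) (hM : M.CovNondegenerate σ)
    (hθ : θ ∈ M.Θ) (hα : α ∈ M.A) (hα₀ : 0 < α) (hδ : 1 ≤ 2 * α * δ)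
    (hθ_lim : θ ∈ closure (M.Θ \ (ℝ ∙ θ))) (ν : Measure Ω) [IsProbabilityMeasure ν]
    (𝒜 : M.Algorithm Ω) {T : ℕ} {q : ℝ}
    (hfair : ∀ θ' ∈ M.Θ, 𝒜.FairWithProb (fun u => u) ν T δ q θ' α) :
    (2 * q - 1) * (T * (σ * ‖θ‖ ^ 2 / (4 * α))) ≤ 𝒜.expectedRegret (fun u => u) ν T δ θ α := by
  let bound (θ' : EuclideanSpace ℝ (Fin d)) : ℝ :=
    (2 * q - 1 - T * ∫ x : M.𝒳, ‖x.1‖ * ‖θ - θ'‖ ∂M.P) * (T * (σ * ‖θ‖ ^ 2 / (4 * α)))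
  have bound_continuous : Continuous bound := by
    simp only [bound, integral_mul_const]
    fun_prop
  have bound_le : ∀ θ' ∈ closure (M.Θ \ (ℝ ∙ θ)),
      bound θ' ≤ 𝒜.expectedRegret (fun u => u) ν T δ θ α :=
    closure_minimal (fun θ' hθ' => le_expectedRegret_of_notMem_span h𝒳 h𝒳_int h hr hM hθ hα hα₀ hδ
      hθ'.2 ν 𝒜 (hfair θ hθ) (hfair θ' hθ'.1)) (isClosed_Iic.preimage bound_continuous)
  simpa [bound] using bound_le θ hθ_lim

end LinearDemand

section SquareModel

/-- The contexts of `squareModel`. They are bounded away from `0`, so that all utilities stay in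
an interval on which the optimal price is interior. -/
def contextSquare : Set (EuclideanSpace ℝ (Fin 2)) := {x | ∀ i, x i ∈ Icc (9 / 10 : ℝ) 1}

/-- The parametrization of `contextSquare` by the unit square, used to define the uniform
distribution on `contextSquare`. -/
def contextOfUnit (w : Fin 2 → unitInterval) : contextSquare :=
  ⟨WithLp.toLp 2 fun i => 1 / 10 * (w i : ℝ) + 9 / 10, fun i =>
    ⟨by linarith [(w i).2.1], by linarith [(w i).2.2]⟩⟩

theorem continuous_contextOfUnit : Continuous contextOfUnit :=
  Continuous.subtype_mk ((PiLp.continuous_toLp 2 _).comp (by fun_prop)) _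

theorem surjective_contextOfUnit : Function.Surjective contextOfUnit := fun x =>
  ⟨fun i => ⟨10 * x.1 i - 9, by linarith [(x.2 i).1], by linarith [(x.2 i).2]⟩, by
    ext i
    simp only [contextOfUnit]
    ring⟩

theorem contextSquare_eq_iInter :
    contextSquare = ⋂ i, (fun x : EuclideanSpace ℝ (Fin 2) => x i) ⁻¹' Icc (9 / 10 : ℝ) 1 :=
  ofPred_forall _

theorem measurableSet_contextSquare : MeasurableSet contextSquare := by
  rw [contextSquare_eq_iInter]
  exact .iInter fun i => measurableSet_Icc.preimage (by fun_prop)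

theorem convex_contextSquare : Convex ℝ contextSquare := by
  rw [contextSquare_eq_iInter]
  exact convex_iInter fun i => (convex_Icc _ _).is_linear_preimage
    (EuclideanSpace.proj i : EuclideanSpace ℝ (Fin 2) →L[ℝ] ℝ).isBoundedLinearMap.toIsLinearMap

theorem nonempty_interior_contextSquare : (interior contextSquare).Nonempty := by
  have isOpen : IsOpen (⋂ i, (fun x : EuclideanSpace ℝ (Fin 2) => x i) ⁻¹' Ioo (9 / 10 : ℝ) 1) :=
    isOpen_iInter_of_finite fun i => isOpen_Ioo.preimage (by fun_prop)
  refine ⟨WithLp.toLp 2 fun _ => 19 / 20, interior_maximal ?_ isOpen (mem_iInter.2 fun i => ?_)⟩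
  · rw [contextSquare_eq_iInter]
    exact iInter_mono fun i => preimage_mono Ioo_subset_Icc_self
  · exact ⟨by norm_num, by norm_num⟩

/-- Uniform contexts on `contextSquare`, utility parameters in `[9/20, 1/2]²` and price
sensitivities in `[a, 5a/4]`. The demand at the highest price `3/(5a)` is then nonnegative, and the
optimal price for a utility in `[3/4, 1]` is below `3/(5a)`. -/
def squareModel (a : ℝ) (ha : 1 ≤ a) : PricingModel 2 where
  𝒳 := contextSquare
  measurableSet_𝒳 := measurableSet_contextSquare
  P := Measure.map contextOfUnit volume
  isProb := Measure.isProbabilityMeasure_map continuous_contextOfUnit.measurable.aemeasurable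
  fullSupport := continuous_contextOfUnit.isOpenPosMeasure_map surjective_contextOfUnit
  pLow := 0
  pHigh := 3 / (5 * a)
  pLow_nonneg := le_rfl
  pLow_lt_pHigh := by positivity
  pHigh_le_one := by
    rw [div_le_one (by positivity)]
    linarith
  Θ := {θ | ∀ i, θ i ∈ Icc (9 / 20 : ℝ) (1 / 2)}
  A := Icc a (5 * a / 4)
  A_nonneg := fun α hα => by linarith [hα.1]

variable {a : ℝ} (ha : 1 ≤ a)

theorem utility_mem_Icc {x θ : EuclideanSpace ℝ (Fin 2)} (hx : x ∈ contextSquare)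
    (hθ : ∀ i, θ i ∈ Icc (9 / 20 : ℝ) (1 / 2)) : utility x θ ∈ Icc (3 / 4 : ℝ) 1 := by
  have mul_mem (i : Fin 2) : θ i * x i ∈ Icc (81 / 200 : ℝ) (1 / 2) := by
    obtain ⟨hx₁, hx₂⟩ := hx i
    obtain ⟨hθ₁, hθ₂⟩ := hθ i
    constructor <;> nlinarith
  have utility_eq : utility x θ = θ 0 * x 0 + θ 1 * x 1 := by
    simp [utility, PiLp.inner_apply, Fin.sum_univ_two]
  rw [utility_eq]
  constructor <;> linarith [(mul_mem 0).1, (mul_mem 0).2, (mul_mem 1).1, (mul_mem 1).2]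

theorem boundedness_squareModel :
    (squareModel a ha).Boundedness (fun u => u) 1 1 (3 / 4) 1 := by
  refine ⟨by norm_num, le_rfl, by norm_num, by norm_num, le_rfl, ?_⟩
  rintro x hx p ⟨hp₀, hp⟩ θ hθ α ⟨hα, hα'⟩
  have hu := utility_mem_Icc hx hθ
  have discount_nonneg : 0 ≤ α * p := mul_nonneg (by linarith) hp₀
  have discount_le : α * p ≤ 3 / 4 :=
    calc α * p ≤ 5 * a / 4 * (3 / (5 * a)) := mul_le_mul hα' hp hp₀ (by positivity)
      _ = 3 / 4 := by field_simp
  have hd : utility x θ - α * p ∈ Icc (0 : ℝ) 1 := ⟨by linarith [hu.1], by linarith [hu.2]⟩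
  exact ⟨hu, ⟨by linarith [hd.1], hd.2⟩, hd⟩

theorem smoothUnimodal_squareModel :
    (squareModel a ha).SmoothUnimodal (fun u => u) 1 (3 / 4) 1 1 2 := by
  refine smoothUnimodal_linear two_pos le_rfl le_rfl (fun α hα => by linarith [hα.1]) ?_
  rintro α ⟨hα, -⟩ u ⟨hu, hu'⟩
  have hα₀ : 0 < α := by linarith
  refine ⟨div_pos (by linarith) (by positivity), ?_⟩
  change u / (2 * α) < 3 / (5 * a)
  rw [div_lt_div_iff₀ (by positivity) (by positivity)]
  nlinarith

theorem stochasticContexts_squareModel : (squareModel a ha).StochasticContexts 1 50 := by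
  intro θ hθ U hU hU_sub
  have hθ₀ : 9 / 20 ≤ θ 0 := (hθ 0).1
  have preimage_eq : contextOfUnit ⁻¹' {x | utility x.1 θ ∈ U} =
      MeasurableEquiv.finTwoArrow ⁻¹' {w : unitInterval × unitInterval |
        θ 0 / 10 * w.1 + (θ 1 / 10 * w.2 + 9 / 10 * (θ 0 + θ 1)) ∈ U} := by
    ext w
    have utility_eq : utility (contextOfUnit w).1 θ =
        θ 0 / 10 * w 0 + (θ 1 / 10 * w 1 + 9 / 10 * (θ 0 + θ 1)) := by
      simp only [utility, contextOfUnit, PiLp.inner_apply, Fin.sum_univ_two, RCLike.inner_apply,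
        conj_trivial]
      ring
    simp only [mem_preimage, mem_ofPred_eq, utility_eq]
    rfl
  have measurableSet : MeasurableSet {x : contextSquare | utility x.1 θ ∈ U} :=
    hU.preimage (measurable_utility (M := squareModel a ha) θ)
  have measure_le : (squareModel a ha).P {x | utility x.1 θ ∈ U} ≤ ENNReal.ofReal 25 * volume U :=
    calc Measure.map contextOfUnit volume {x | utility x.1 θ ∈ U}
        = volume {w : unitInterval × unitInterval |
          θ 0 / 10 * w.1 + (θ 1 / 10 * w.2 + 9 / 10 * (θ 0 + θ 1)) ∈ U} := by
          rw [Measure.map_apply continuous_contextOfUnit.measurable measurableSet, preimage_eq,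
            (volume_preserving_finTwoArrow unitInterval).measure_preimage_equiv]
      _ ≤ ENNReal.ofReal |(θ 0 / 10)⁻¹| * volume U :=
          prod_setOf_mul_add_mem_le volume (by positivity)
            (g := fun v : unitInterval => θ 1 / 10 * v + 9 / 10 * (θ 0 + θ 1)) (by fun_prop) hU
      _ ≤ ENNReal.ofReal 25 * volume U := by
          gcongr
          rw [abs_of_pos (by positivity), inv_div, div_le_iff₀ (by positivity)]
          linarith
  have hU_fin : volume U ≠ ⊤ := ne_top_of_le_ne_top (by simp) (measure_mono hU_sub)
  calc (squareModel a ha).P.real {x | utility x.1 θ ∈ U}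
      ≤ (ENNReal.ofReal 25 * volume U).toReal :=
        ENNReal.toReal_mono (ENNReal.mul_ne_top ENNReal.ofReal_ne_top hU_fin) measure_le
    _ = 50 * volume.real U / (2 * 1) := by
        rw [ENNReal.toReal_mul, ENNReal.toReal_ofReal (by norm_num), Measure.real]
        ring

theorem memLp_squareModel : MemLp (fun x : (squareModel a ha).𝒳 => x.1) 2 (squareModel a ha).P := by
  have memLp_comp : MemLp (fun w => (contextOfUnit w).1) 2 :=
    (continuous_subtype_val.comp continuous_contextOfUnit).memLp_of_hasCompactSupport
      (.of_compactSpace _)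
  exact (memLp_map_measure_iff measurable_subtype_coe.aestronglyMeasurable
    continuous_contextOfUnit.measurable.aemeasurable).2 memLp_comp

theorem covMatrix_squareModel : (squareModel a ha).covMatrix = (1 / 1200 : ℝ) • 1 := by
  ext i j
  have integrable (k : Fin 2) :
      Integrable fun w : Fin 2 → unitInterval => 1 / 10 * (w k : ℝ) :=
    Continuous.integrable_of_hasCompactSupport (by fun_prop) (.of_compactSpace _)
  calc (squareModel a ha).covMatrix i j
      = cov[fun x : contextSquare => x.1 i, fun x => x.1 j; Measure.map contextOfUnit volume] :=
        covMatrix_apply (memLp_squareModel ha) i j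
    _ = cov[fun w : Fin 2 → unitInterval => 1 / 10 * (w i : ℝ) + 9 / 10,
          fun w => 1 / 10 * (w j : ℝ) + 9 / 10] :=
        covariance_map_fun (by fun_prop) (by fun_prop)
          continuous_contextOfUnit.measurable.aemeasurable
    _ = 1 / 10 * (1 / 10 * if i = j then 1 / 12 else 0) := by
        rw [covariance_add_const_left (integrable i), covariance_add_const_right (integrable j),
          covariance_const_mul_left, covariance_const_mul_right, volume_pi,
          covariance_pi (memLp_unitInterval_coe 2), variance_unitInterval_coe]
    _ = ((1 / 1200 : ℝ) • (1 : Matrix (Fin 2) (Fin 2) ℝ)) i j := by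
        rw [Matrix.smul_apply, Matrix.one_apply]
        split_ifs <;> norm_num

theorem covNondegenerate_squareModel : (squareModel a ha).CovNondegenerate (1 / 1200) := by
  refine ⟨by norm_num, memLp_squareModel ha, ?_⟩
  rw [covMatrix_squareModel, sub_self]
  exact Matrix.PosSemidef.zero

theorem assumptions_squareModel : (squareModel a ha).Assumptions (fun u => u) :=
  ⟨1, 1, 3 / 4, 1, 1, 2, 50, 1 / 1200, boundedness_squareModel ha, smoothUnimodal_squareModel ha,
    stochasticContexts_squareModel ha, covNondegenerate_squareModel ha⟩

/-- The corner `(1/2, 1/2)` of the parameter square, the instance with large regret. -/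
def cornerParameter : EuclideanSpace ℝ (Fin 2) := !₂[1 / 2, 1 / 2]

theorem norm_cornerParameter_sq : ‖cornerParameter‖ ^ 2 = 1 / 2 := by
  rw [EuclideanSpace.real_norm_sq_eq, Fin.sum_univ_two]
  norm_num [cornerParameter]

theorem cornerParameter_mem : cornerParameter ∈ (squareModel a ha).Θ := by
  intro i
  fin_cases i <;> norm_num [cornerParameter]

theorem cornerParameter_mem_closure :
    cornerParameter ∈ closure ((squareModel a ha).Θ \ (ℝ ∙ cornerParameter)) := by
  let tilted (ε : ℝ) : EuclideanSpace ℝ (Fin 2) := !₂[1 / 2, 1 / 2 - ε]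
  have tilted_continuous : Continuous tilted := by
    refine (PiLp.continuous_toLp 2 _).comp (continuous_pi fun i => ?_)
    fin_cases i
    · exact continuous_const
    · exact continuous_const.sub continuous_id
  have tilted_tendsto :
      Filter.Tendsto tilted (nhdsWithin 0 (Ioi 0)) (nhds cornerParameter) :=
    (tilted_continuous.tendsto' 0 _ (by simp [tilted, cornerParameter])).mono_left
      nhdsWithin_le_nhds
  refine mem_closure_of_tendsto tilted_tendsto ?_
  filter_upwards [Ioc_mem_nhdsGT (by norm_num : (0 : ℝ) < 1 / 20)] with ε ⟨hε₀, hε⟩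
  refine ⟨fun i => ?_, fun h_parallel => ?_⟩
  · fin_cases i
    · norm_num [tilted]
    · change (1 / 2 - ε : ℝ) ∈ Icc (9 / 20 : ℝ) (1 / 2)
      constructor <;> linarith
  · obtain ⟨r, hr⟩ := Submodule.mem_span_singleton.1 h_parallel
    have coord_zero : r * (1 / 2) = 1 / 2 := congrArg (fun x => x 0) hr
    have coord_one : r * (1 / 2) = 1 / 2 - ε := congrArg (fun x => x 1) hr
    linarith

theorem hasOptimalFairPolicy_squareModel {δ α : ℝ} (hδ : 1 ≤ 2 * a * δ)
    {θ : EuclideanSpace ℝ (Fin 2)} (hθ : θ ∈ (squareModel a ha).Θ)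
    (hα : α ∈ (squareModel a ha).A) :
    (squareModel a ha).HasOptimalFairPolicy (fun u => u) δ θ α := by
  have hδ₀ : 0 < δ := pos_of_mul_pos_right (by linarith : 0 < 2 * a * δ) (by linarith)
  refine hasOptimalFairPolicy_linear (boundedness_squareModel ha) (smoothUnimodal_squareModel ha)
    (memLp_squareModel ha) hθ hα (by linarith [hα.1]) (hδ.trans ?_)
  gcongr
  exact hα.1

theorem linear_le_worstCaseRegret_squareModel {δ q : ℝ} {T : ℕ} (hδ : 1 ≤ 2 * a * δ)
    (ν : Measure Ω) [IsProbabilityMeasure ν] (𝒜 : (squareModel a ha).Algorithm Ω)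
    (hfair : ∀ θ ∈ (squareModel a ha).Θ, 𝒜.FairWithProb (fun u => u) ν T δ q θ a) :
    (((2 * q - 1) / (9600 * a) * T : ℝ) : EReal) ≤ 𝒜.worstCaseRegret (fun u => u) ν T δ := by
  have ha_mem : a ∈ (squareModel a ha).A := ⟨le_rfl, by linarith⟩
  refine le_iSup₂_of_le cornerParameter (cornerParameter_mem ha) <|
    le_iSup₂_of_le a ha_mem <| EReal.coe_le_coe_iff.2 ?_
  calc (2 * q - 1) / (9600 * a) * T
      = (2 * q - 1) * (T * (1 / 1200 * ‖cornerParameter‖ ^ 2 / (4 * a))) := by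
        rw [norm_cornerParameter_sq]
        ring
    _ ≤ 𝒜.expectedRegret (fun u => u) ν T δ cornerParameter a :=
        linear_le_expectedRegret convex_contextSquare nonempty_interior_contextSquare
          (boundedness_squareModel ha) (smoothUnimodal_squareModel ha)
          (covNondegenerate_squareModel ha) (cornerParameter_mem ha) ha_mem (by linarith) hδ
          (cornerParameter_mem_closure ha) ν 𝒜 hfair

end SquareModel

end PricingModel

end

theorem exists_forall_natCast_rpow_le_mul {s κ : ℝ} (hs : s < 1) (hκ : 0 < κ) :
    ∃ T₀ : ℕ, ∀ T : ℕ, T₀ ≤ T → (T : ℝ) ^ s ≤ κ * T := by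
  have tendsto_zero : Filter.Tendsto (fun T : ℕ => (T : ℝ) ^ (-(1 - s))) Filter.atTop (nhds 0) :=
    (tendsto_rpow_neg_atTop (sub_pos.2 hs)).comp tendsto_natCast_atTop_atTop
  refine Filter.eventually_atTop.1 ?_
  filter_upwards [tendsto_zero.eventually_le_const hκ, Filter.eventually_gt_atTop 0] with T hT hT₀
  have cast_pos : (0 : ℝ) < T := by exact_mod_cast hT₀
  calc (T : ℝ) ^ s = (T : ℝ) ^ (-(1 - s)) * T := by
        rw [← Real.rpow_add_one cast_pos.ne']
        congr 1
        ring
    _ ≤ κ * T := by gcongr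

theorem natCast_rpow_le_self {s : ℝ} (hs₀ : 0 < s) (hs : s ≤ 1) (T : ℕ) : (T : ℝ) ^ s ≤ T := by
  rcases T.eq_zero_or_pos with rfl | hT
  · simp [hs₀.ne']
  · exact Real.rpow_le_self_of_one_le (by exact_mod_cast hT) hs

open PricingModel in
theorem mainTheorem2_general (δ₀ : ℝ) (hδ₀ : 0 < δ₀) :
    ∃ (d : ℕ) (M : PricingModel d), M.Assumptions (fun u => u) ∧
      (∀ θ ∈ M.Θ, ∀ α ∈ M.A, M.HasOptimalFairPolicy (fun u => u) δ₀ θ α) ∧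
      ∀ (T : ℕ) (q : ℝ) (Ω : Type*) (_ : MeasurableSpace Ω) (ν : Measure Ω),
        IsProbabilityMeasure ν → ∀ 𝒜 : M.Algorithm Ω,
          (∀ θ ∈ M.Θ, ∀ α ∈ M.A, 𝒜.FairWithProb (fun u => u) ν T δ₀ q θ α) →
            (((2 * q - 1) * min 1 (2 * δ₀) / 9600 * T : ℝ) : EReal) ≤
              𝒜.worstCaseRegret (fun u => u) ν T δ₀ := by
  obtain ⟨a, ha_inv⟩ : ∃ a, a⁻¹ = min 1 (2 * δ₀) := ⟨_, inv_inv _⟩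
  have ha₀ : 0 < a := inv_pos.1 (ha_inv ▸ by positivity)
  have ha : 1 ≤ a := (inv_le_one₀ ha₀).1 (ha_inv ▸ min_le_left _ _)
  have ha_fair : 1 ≤ 2 * a * δ₀ := by
    have := (inv_le_iff_one_le_mul₀ ha₀).1 (ha_inv ▸ min_le_right 1 (2 * δ₀))
    linarith
  refine ⟨2, squareModel a ha, assumptions_squareModel ha,
    fun θ hθ α hα => hasOptimalFairPolicy_squareModel ha ha_fair hθ hα,
    fun T q Ω _ ν _ 𝒜 hfair => ?_⟩
  convert linear_le_worstCaseRegret_squareModel ha ha_fair ν 𝒜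
    fun θ hθ => hfair θ hθ a ⟨le_rfl, by linarith⟩ using 2
  rw [← ha_inv]
  ring

theorem mainTheorem2 :
    ∃ c : ℝ, 0 < c ∧ ∀ δ₀ : ℝ, 0 < δ₀ → δ₀ ≤ 1 / 2 →
      ∃ (C : ℝ) (T₀ : ℕ) (d : ℕ) (M : PricingModel d), 0 < C ∧
        M.Assumptions (fun u => u) ∧
        (∀ θ ∈ M.Θ, ∀ α ∈ M.A, M.HasOptimalFairPolicy (fun u => u) δ₀ θ α) ∧
        ∀ (T : ℕ) (Ω : Type*) (_ : MeasurableSpace Ω) (ν : Measure Ω), IsProbabilityMeasure ν →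
          ∀ 𝒜 : M.Algorithm Ω,
            (∀ θ ∈ M.Θ, ∀ α ∈ M.A, 𝒜.FairWithProb (fun u => u) ν T δ₀ 0.95 θ α) →
              ((C * (T : ℝ) ^ (2 / 3 : ℝ) : ℝ) : EReal) ≤
                  𝒜.worstCaseRegret (fun u => u) ν T δ₀ ∧
              (T₀ ≤ T →
                ((c * δ₀ ^ (2 / 3 : ℝ) * (T : ℝ) ^ (2 / 3 : ℝ) : ℝ) : EReal) ≤
                  𝒜.worstCaseRegret (fun u => u) ν T δ₀) := by
  refine ⟨1, one_pos, fun δ₀ hδ₀ hδ₀' => ?_⟩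
  obtain ⟨d, M, assumptions, optimal, regret_ge⟩ := mainTheorem2_general δ₀ hδ₀
  have hC : 0 < (2 * 0.95 - 1) * min 1 (2 * δ₀) / 9600 := by
    rw [min_eq_right (by linarith)]
    positivity
  obtain ⟨T₀, hT₀⟩ := exists_forall_natCast_rpow_le_mul (by norm_num : (2 / 3 : ℝ) < 1) hC
  refine ⟨_, T₀, d, M, hC, assumptions, optimal, fun T Ω _ ν hν 𝒜 hfair => ?_⟩
  have regret_ge := regret_ge T 0.95 Ω _ ν hν 𝒜 hfair
  refine ⟨regret_ge.trans' (EReal.coe_le_coe_iff.2 ?_),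
    fun hT => regret_ge.trans' (EReal.coe_le_coe_iff.2 ?_)⟩
  · exact mul_le_mul_of_nonneg_left (natCast_rpow_le_self (by norm_num) (by norm_num) T) hC.le
  · calc 1 * δ₀ ^ (2 / 3 : ℝ) * (T : ℝ) ^ (2 / 3 : ℝ) ≤ (T : ℝ) ^ (2 / 3 : ℝ) := by
          rw [one_mul]
          exact mul_le_of_le_one_left (by positivity)
            (Real.rpow_le_one hδ₀.le (by linarith) (by norm_num))
      _ ≤ _ := hT₀ T hT
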